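/- Let $n\ge 1$. A convex body in $\mathbb{R}^n$ is a compact convex set with nonempty interior. For a convex body $K\subset\mathbb{R}^n$ with volume $\mathrm{vol}(K)$ and Euclidean diameter $\mathrm{D}(K)$, the isodiametric quotient is $\mathrm{iq}(K)=\mathrm{vol}(K)/\mathrm{D}(K)^n$, and $K$ is in Behrend position if $\mathrm{iq}(K)=\max_{A\in \mathrm{GL}_n(\mathbb{R})}\mathrm{iq}(AK)$. Put $$b_n=\frac{1}{\sqrt{n!}\,n^{n/2}},\qquad a_n=\frac{\sqrt{n+1}}{n!\,e^{n/2}}.$$ 1. For every $n\ge1$, every convex body $K\subset\mathbb{R}^n$ in Behrend position satisfies $\mathrm{iq}(K)\ge b_n$. 2. As $n\to\infty$, the bound $b_n$ agrees with $a_n$ up to a factor of order $n^{-1/4}$, in the precise form $$b_n\sim\frac{(2\pi n)^{1/4}}{\sqrt{n+1}}\,a_n=\frac{(2\pi n)^{1/4}}{n!\,e^{n/2}},$$ where $\sim$ means that the ratio of the two sides tends to $1$. In particular $(b_n/a_n)^{1/n}\to1$, that is, $b_n$ and $a_n$ agree to exponential order. 3. Consequently, for every $c\in(0,1)$ there is an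 $N$ such that for all $n\ge N$ every convex body $K\subset\mathbb{R}^n$ in Behrend position satisfies $$\mathrm{iq}(K)\ge c^n\,\frac{\sqrt{n+1}}{n!\,e^{n/2}}.$$ -/

import Mathlib

open MeasureTheory Filter Topology Asymptotics
open scoped Nat

noncomputable section

/-- The isodiametric quotient `vol(K) / D(K) ^ n` of a set `K` in `n`-dimensional Euclidean
space, where `vol` is Lebesgue measure and `D` is the Euclidean diameter. -/
def isodiametricQuotient {n : ℕ} (K : Set (EuclideanSpace ℝ (Fin n))) : ℝ :=
  volume.real K / Metric.diam K ^ n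

/-- `K` is in Behrend (isodiametric) position: `iq(K)` is the maximum of `iq(A K)` over all
invertible linear maps `A` of `n`-dimensional Euclidean space. -/
def IsBehrendPosition {n : ℕ} (K : ConvexBody (EuclideanSpace ℝ (Fin n))) : Prop :=
  IsGreatest
    (Set.range fun A : EuclideanSpace ℝ (Fin n) ≃ₗ[ℝ] EuclideanSpace ℝ (Fin n) =>
      isodiametricQuotient (A '' (K : Set (EuclideanSpace ℝ (Fin n)))))
    (isodiametricQuotient (K : Set (EuclideanSpace ℝ (Fin n))))

/-- The lower bound `1 / (√(n!) n^(n/2))`. -/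
def behrendBound (n : ℕ) : ℝ :=
  1 / (Real.sqrt (n ! : ℝ) * (n : ℝ) ^ ((n : ℝ) / 2))

/-- The comparison sequence `√(n+1) / (n! e^(n/2))`. -/
def comparisonBound (n : ℕ) : ℝ :=
  Real.sqrt ((n : ℝ) + 1) / ((n ! : ℝ) * Real.exp ((n : ℝ) / 2))

end

/-! Let `K` be in Behrend position with diameter `D`. Stretching `K` by `√(1 + σ)` on `Fᗮ`
multiplies its volume by `(1 + σ) ^ ((n - dim F) / 2)`, and `D ^ 2` grows by at most `σ * p ^ 2`,
where `p` is the largest length of the projection to `Fᗮ` of a difference of two points of `K`.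
Maximality as `σ → 0` forces `p ^ 2 ≥ (n - dim F) / n * D ^ 2` (`exists_le_norm_starProjection`).

Greedily choosing differences `u i` far from the span of the earlier ones gives Gram–Schmidt vectors
of length at least `√((n - i) / n) * D`, hence `|det u| ≥ √(n! / n ^ n) * D ^ n`
(`exists_orthonormalBasis_det`). A convex body containing translates of the segments `[0, u i]` has
volume at least `|det u| / n!` (`abs_det_le_factorial_mul_volume`), and the quotient of the two is
`b_n`.

The asymptotics are the square root of Stirling's formula; polynomial factors disappear under `n`-th
roots, which gives the bound with `c ^ n`. -/

/-! ### Asymptotics of the bound -/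

theorem behrendBound_isEquivalent :
    behrendBound ~[atTop] fun n : ℕ =>
      (2 * Real.pi * (n : ℝ)) ^ (1 / 4 : ℝ) / Real.sqrt ((n : ℝ) + 1) * comparisonBound n := by
  have hS := Stirling.factorial_isEquivalent_stirling
  have hne : ∀ᶠ n : ℕ in atTop, √(2 * n * Real.pi) * (n / Real.exp 1) ^ n ≠ 0 := by
    filter_upwards [eventually_gt_atTop 0] with n hn
    positivity
  have h1 := (isEquivalent_iff_tendsto_one hne).1 hS
  -- The ratio of the two sides of the claim is exactly the square root of `n!` over its Stirling
  -- approximation.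
  have h2 := h1.sqrt
  rw [Real.sqrt_one] at h2
  refine (isEquivalent_iff_tendsto_one ?_).2 (h2.congr' ?_)
  · filter_upwards [eventually_gt_atTop 0] with n hn
    unfold comparisonBound
    positivity
  · filter_upwards [eventually_gt_atTop 0] with n hn
    have hn' : (0 : ℝ) < n := by exact_mod_cast hn
    have e1 : (n : ℝ) ^ ((n : ℝ) / 2) = √((n : ℝ) ^ n) := by
      rw [Real.sqrt_eq_rpow, ← Real.rpow_natCast, ← Real.rpow_mul hn'.le]
      congr 1; ring
    have e2 : Real.exp ((n : ℝ) / 2) = √(Real.exp 1 ^ n) := by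
      rw [Real.exp_half, ← Real.exp_nat_mul, mul_one]
    have e3 : (2 * Real.pi * (n : ℝ)) ^ (1 / 4 : ℝ) = √(√(2 * n * Real.pi)) := by
      rw [Real.sqrt_eq_rpow, Real.sqrt_eq_rpow, ← Real.rpow_mul (by positivity)]
      congr 1 <;> ring
    simp only [Pi.div_apply, behrendBound, comparisonBound]
    rw [e1, e2, e3, Real.sqrt_div (by positivity), Real.sqrt_mul (by positivity), div_pow,
      Real.sqrt_div (by positivity)]
    have hf : (n ! : ℝ) = √(n ! : ℝ) * √(n ! : ℝ) := (Real.mul_self_sqrt (by positivity)).symm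
    have : 0 < √(n ! : ℝ) := by positivity
    have : 0 < √((n : ℝ) ^ n) := by positivity
    have : 0 < √(Real.exp 1 ^ n) := by positivity
    have : 0 < √(√(2 * n * Real.pi)) := by positivity
    have : 0 < √((n : ℝ) + 1) := by positivity
    generalize √(n ! : ℝ) = f at *
    rw [hf]
    field_simp

theorem tendsto_rpow_one_div_of_tendsto_pos {u : ℕ → ℝ} {l : ℝ} (hl : 0 < l)
    (hu : Tendsto u atTop (𝓝 l)) : Tendsto (fun n : ℕ => u n ^ (1 / (n : ℝ))) atTop (𝓝 1) := by
  have := hu.rpow tendsto_one_div_atTop_nhds_zero_nat (Or.inl hl.ne')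
  simpa using this

theorem tendsto_behrendBound_div_comparisonBound_rpow :
    Tendsto (fun n : ℕ => (behrendBound n / comparisonBound n) ^ (1 / (n : ℝ))) atTop (𝓝 1) := by
  have hne : ∀ᶠ n : ℕ in atTop,
      (2 * Real.pi * (n : ℝ)) ^ (1 / 4 : ℝ) / Real.sqrt ((n : ℝ) + 1) * comparisonBound n ≠ 0 := by
    filter_upwards [eventually_gt_atTop 0] with n hn
    unfold comparisonBound
    positivity
  have h1 := (isEquivalent_iff_tendsto_one hne).1 behrendBound_isEquivalent
  have hA := tendsto_rpow_one_div_of_tendsto_pos one_pos h1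
  have hB := tendsto_rpow_one_div_of_tendsto_pos (u := fun _ => (2 * Real.pi) ^ (1 / 4 : ℝ))
    (by positivity) tendsto_const_nhds
  have hC := (tendsto_rpow_div.comp (tendsto_natCast_atTop_atTop (R := ℝ))).rpow_const
    (p := 1 / 4) (Or.inl one_ne_zero)
  have hD : Tendsto (fun n : ℕ => (((n : ℝ) + 1) ^ (1 / (n : ℝ))) ^ (1 / 2 : ℝ)) atTop (𝓝 1) := by
    -- The limit of `x ^ (1 / (x - 1))` along `x = n + 1`.
    have h := (tendsto_rpow_div_mul_add 1 1 (-1) one_ne_zero.symm).comp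
      ((tendsto_add_atTop_iff_nat 1).2 (tendsto_natCast_atTop_atTop (R := ℝ)))
    have h' := h.rpow_const (p := 1 / 2) (Or.inl one_ne_zero)
    rw [Real.one_rpow] at h'
    refine h'.congr fun n => ?_
    simp
  have h := ((hA.mul (hB.mul hC)).div hD one_ne_zero)
  simp only [Real.one_rpow, mul_one, div_one] at h
  refine h.congr' ?_
  filter_upwards [eventually_gt_atTop 0] with n hn
  have hn' : (0 : ℝ) < n := by exact_mod_cast hn
  have hcp : 0 < comparisonBound n := by unfold comparisonBound; positivity
  have hbp : 0 < behrendBound n := by unfold behrendBound; positivity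
  simp only [Pi.div_apply, Function.comp]
  have hcomm : ∀ x a : ℝ, 0 ≤ x → (x ^ (1 / (n : ℝ))) ^ a = (x ^ a) ^ (1 / (n : ℝ)) :=
    fun x a hx => by rw [← Real.rpow_mul hx, mul_comm, Real.rpow_mul hx]
  rw [hcomm _ _ hn'.le, hcomm _ _ (by positivity),
    ← Real.mul_rpow (by positivity) (by positivity), ← Real.mul_rpow (by positivity) (by positivity),
    ← Real.div_rpow (by positivity) (by positivity),
    Real.mul_rpow (by positivity : 0 ≤ 2 * Real.pi) hn'.le, Real.sqrt_eq_rpow]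
  congr 1
  field_simp

theorem eventually_pow_mul_comparisonBound_le {c : ℝ} (hc : 0 < c) (hc1 : c < 1) :
    ∀ᶠ n : ℕ in atTop, c ^ n * comparisonBound n ≤ behrendBound n := by
  filter_upwards [tendsto_behrendBound_div_comparisonBound_rpow.eventually_const_lt hc1,
    eventually_gt_atTop 0] with n h hn
  have hn' : (n : ℝ) ≠ 0 := by positivity
  have hcp : 0 < comparisonBound n := by unfold comparisonBound; positivity
  have hbp : 0 < behrendBound n := by unfold behrendBound; positivity
  rw [← le_div_iff₀ hcp]
  calc c ^ n ≤ ((behrendBound n / comparisonBound n) ^ (1 / (n : ℝ))) ^ n := by gcongr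
    _ = behrendBound n / comparisonBound n := by
      rw [← Real.rpow_natCast, ← Real.rpow_mul (by positivity), one_div_mul_cancel hn',
        Real.rpow_one]

/-! ### Volume of a convex body containing given segments -/

theorem lintegral_Ioo_one_sub_pow (d : ℕ) :
    ∫⁻ t in Set.Ioo (0 : ℝ) 1, ENNReal.ofReal ((1 - t) ^ d) = ((d : ENNReal) + 1)⁻¹ := by
  have hi : IntegrableOn (fun t : ℝ => (1 - t) ^ d) (Set.Ioo 0 1) :=
    (Continuous.integrableOn_Icc (by fun_prop)).mono_set Set.Ioo_subset_Icc_self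
  rw [← ofReal_integral_eq_lintegral_ofReal hi]
  · rw [← integral_Ioc_eq_integral_Ioo, ← intervalIntegral.integral_of_le zero_le_one,
      intervalIntegral.integral_comp_sub_left (fun x : ℝ => x ^ d) 1, integral_pow]
    simp only [sub_self, sub_zero, one_pow, ne_eq, Nat.add_eq_zero_iff, one_ne_zero, and_false,
      not_false_eq_true, zero_pow]
    rw [one_div, ENNReal.ofReal_inv_of_pos (by positivity), ENNReal.ofReal_add (by positivity)
      zero_le_one]
    simp
  · filter_upwards [ae_restrict_mem measurableSet_Ioo] with t ht
    exact pow_nonneg (by linarith [ht.2]) d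

/-- A compact convex set in `ℝ × F` containing a unit segment in the first direction has volume
at least `1 / (dim F + 1)` times that of its projection to `F`. -/
theorem measure_snd_image_le_of_unit_segment {F : Type*} [NormedAddCommGroup F] [NormedSpace ℝ F]
    [FiniteDimensional ℝ F] [MeasurableSpace F] [BorelSpace F] (μ : Measure F)
    [μ.IsAddHaarMeasure] {S : Set (ℝ × F)} (hS : IsCompact S) (hc : Convex ℝ S) {s₀ : ℝ} {z₀ : F}
    (h₀ : (s₀, z₀) ∈ S) (h₁ : (s₀ + 1, z₀) ∈ S) :
    μ (Prod.snd '' S) ≤ ((Module.finrank ℝ F : ENNReal) + 1) * ((volume : Measure ℝ).prod μ) S := by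
  set d := Module.finrank ℝ F
  set L : F → ENNReal := fun z => volume ((fun t : ℝ => (t, z)) ⁻¹' S) with hL
  have hLm : Measurable L := measurable_measure_prodMk_right hS.measurableSet
  have hLfin : ∀ z, L z ≠ ⊤ := fun z => by
    have : (fun t : ℝ => (t, z)) ⁻¹' S ⊆ Prod.fst '' S := fun t ht => ⟨(t, z), ht, rfl⟩
    exact measure_ne_top_of_subset this (hS.image continuous_fst).measure_ne_top
  have hvol : ((volume : Measure ℝ).prod μ) S = ∫⁻ z, ENNReal.ofReal (L z).toReal ∂μ := by
    rw [Measure.prod_apply_symm hS.measurableSet]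
    exact lintegral_congr fun z => (ENNReal.ofReal_toReal (hLfin z)).symm
  rw [lintegral_eq_lintegral_meas_le μ (Eventually.of_forall fun z => ENNReal.toReal_nonneg)
    hLm.ennreal_toReal.aemeasurable] at hvol
  -- Shrinking the projection towards `z₀` by `1 - t` lands where fibres have length at least `t`;
  -- the layer-cake formula then integrates `(1 - t) ^ d`.
  have key : ∀ t ∈ Set.Ioo (0 : ℝ) 1, ENNReal.ofReal ((1 - t) ^ d) * μ (Prod.snd '' S) ≤
      μ {z | t ≤ (L z).toReal} := by
    rintro t ⟨ht0, ht1⟩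
    have h := Measure.addHaar_image_homothety μ z₀ (1 - t) (Prod.snd '' S)
    rw [abs_of_nonneg (pow_nonneg (by linarith) _)] at h
    rw [← h]
    refine measure_mono ?_
    rintro _ ⟨_, ⟨⟨s, z⟩, hz, rfl⟩, rfl⟩
    simp only [Set.mem_ofPred_eq]
    rw [← ENNReal.ofReal_le_iff_le_toReal (hLfin _)]
    -- This is `t` times the unit segment over `z₀` plus `(1 - t)` times the point `(s, z)`.
    have hsub : Set.Icc (t * s₀ + (1 - t) * s) (t * s₀ + (1 - t) * s + t) ⊆
        (fun r : ℝ => (r, AffineMap.homothety z₀ (1 - t) z)) ⁻¹' S := by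
      rintro r ⟨hr0, hr1⟩
      set a := (r - (t * s₀ + (1 - t) * s)) / t with ha
      have ha0 : 0 ≤ a := div_nonneg (by linarith) ht0.le
      have ha1 : a ≤ 1 := (div_le_one ht0).2 (by linarith)
      have hta : t * a = r - (t * s₀ + (1 - t) * s) := by rw [ha]; field_simp
      have hm : (s₀ + a, z₀) ∈ S := by
        have := hc h₀ h₁ (sub_nonneg.2 ha1) ha0 (by ring)
        convert this using 1
        ext
        · simp; ring
        · simp [← add_smul]
      have := hc hm hz ht0.le (by linarith : 0 ≤ 1 - t) (by ring)
      rw [Set.mem_preimage]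
      convert this using 1
      ext
      · simp only [Prod.smul_mk, Prod.mk_add_mk, smul_eq_mul]
        linarith
      · simp only [AffineMap.homothety_apply, vsub_eq_sub, vadd_eq_add, Prod.smul_mk, Prod.mk_add_mk]
        module
    calc ENNReal.ofReal t = volume (Set.Icc (t * s₀ + (1 - t) * s) (t * s₀ + (1 - t) * s + t)) := by
          rw [Real.volume_Icc]; congr 1; ring
      _ ≤ _ := measure_mono hsub
  have hle : ((d : ENNReal) + 1)⁻¹ * μ (Prod.snd '' S) ≤ ((volume : Measure ℝ).prod μ) S := by
    rw [hvol, ← lintegral_Ioo_one_sub_pow, ← lintegral_mul_const _ (by fun_prop)]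
    exact (setLIntegral_mono' measurableSet_Ioo key).trans
      (lintegral_mono_set Set.Ioo_subset_Ioi_self)
  have hd0 : (d : ENNReal) + 1 ≠ 0 := by simp
  have hdt : (d : ENNReal) + 1 ≠ ⊤ := by simp
  calc μ (Prod.snd '' S) = ((d : ENNReal) + 1) * (((d : ENNReal) + 1)⁻¹ * μ (Prod.snd '' S)) := by
        rw [← mul_assoc, ENNReal.mul_inv_cancel hd0 hdt, one_mul]
    _ ≤ _ := by gcongr

/-- A compact convex set in `ℝⁿ` containing a translate of each coordinate unit segment has volume
at least `1 / n!`. -/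
theorem one_le_factorial_mul_volume_of_unit_segments : ∀ {n : ℕ} {K : Set (Fin n → ℝ)},
    IsCompact K → Convex ℝ K → K.Nonempty →
    (∀ i, ∃ x ∈ K, x + Pi.single i 1 ∈ K) → 1 ≤ (n ! : ENNReal) * volume K
  | 0, K, _, _, hne, _ => by
    have : K = Set.univ := by
      obtain ⟨x, hx⟩ := hne
      exact Set.eq_univ_of_forall fun y => Subsingleton.elim x y ▸ hx
    simp [this, volume_pi]
  | n + 1, K, hK, hc, hne, h => by
    let e := MeasurableEquiv.piFinSuccAbove (fun _ : Fin (n + 1) => ℝ) 0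
    let g : (Fin (n + 1) → ℝ) →L[ℝ] ℝ × (Fin n → ℝ) :=
      (ContinuousLinearMap.proj 0).prod (ContinuousLinearMap.pi fun i =>
        ContinuousLinearMap.proj i.succ)
    have heg : ∀ x, e x = g x := fun x => by
      ext
      · rfl
      · simp [e, g, MeasurableEquiv.piFinSuccAbove, Fin.tail]
    have hvol : volume K = ((volume : Measure ℝ).prod volume) (g '' K) := by
      rw [← Set.image_congr fun x _ => heg x, e.image_eq_preimage_symm]
      exact ((volume_preserving_piFinSuccAbove (fun _ : Fin (n + 1) => ℝ) 0).symm
        |>.measure_preimage_equiv K).symm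
    have hgK : IsCompact (g '' K) := hK.image g.continuous
    have hgc : Convex ℝ (g '' K) := hc.linear_image g.toLinearMap
    obtain ⟨x₀, hx₀, hx₁⟩ := h 0
    have h1 := measure_snd_image_le_of_unit_segment volume hgK hgc (s₀ := x₀ 0)
      (z₀ := fun i => x₀ i.succ) ⟨x₀, hx₀, rfl⟩ ⟨_, hx₁, by ext <;> simp [g]⟩
    rw [Module.finrank_fin_fun, ← hvol] at h1
    have h2 := one_le_factorial_mul_volume_of_unit_segments (n := n) (K := Prod.snd '' (g '' K))
      (hgK.image continuous_snd) (hgc.linear_image (LinearMap.snd ℝ ℝ _))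
      ((hne.image _).image _) fun i => by
        obtain ⟨x, hx, hx'⟩ := h i.succ
        refine ⟨_, ⟨_, ⟨x, hx, rfl⟩, rfl⟩, _, ⟨_, hx', rfl⟩, ?_⟩
        ext j
        simp [g, Pi.single_apply]
    calc (1 : ENNReal) ≤ (n ! : ENNReal) * volume (Prod.snd '' (g '' K)) := h2
      _ ≤ (n ! : ENNReal) * (((n : ENNReal) + 1) * volume K) := by gcongr
      _ = _ := by rw [Nat.factorial_succ]; push_cast; ring

/-- A compact convex set in `ℝⁿ` containing segments parallel to `u₁, …, uₙ`, of the same lengths,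
has volume at least `|det (u₁, …, uₙ)| / n!`. -/
theorem abs_det_le_factorial_mul_volume {n : ℕ} {K : Set (EuclideanSpace ℝ (Fin n))}
    (hK : IsCompact K) (hc : Convex ℝ K) (hne : K.Nonempty)
    (b : OrthonormalBasis (Fin n) ℝ (EuclideanSpace ℝ (Fin n)))
    (u : Fin n → EuclideanSpace ℝ (Fin n)) (hu : ∀ i, ∃ x ∈ K, x + u i ∈ K) :
    |b.toBasis.det u| ≤ (n ! : ℝ) * volume.real K := by
  by_cases hdet : b.toBasis.det u = 0
  · rw [hdet, abs_zero]; positivity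
  let f : EuclideanSpace ℝ (Fin n) →ₗ[ℝ] EuclideanSpace ℝ (Fin n) := b.toBasis.constr ℝ u
  have hfb : ∀ i, f (b i) = u i := fun i => by
    rw [← b.coe_toBasis]; exact b.toBasis.constr_basis ℝ u i
  have hfdet : LinearMap.det f = b.toBasis.det u := by
    rw [← LinearMap.det_toMatrix b.toBasis, Module.Basis.det_apply]
    congr 1
    ext i j
    simp [LinearMap.toMatrix_apply, Module.Basis.toMatrix_apply, hfb]
  let A := LinearEquiv.ofIsUnitDet (f := f) (v := b.toBasis) (v' := b.toBasis)
    (by rw [LinearMap.det_toMatrix, hfdet]; exact isUnit_iff_ne_zero.2 hdet)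
  have hA : ∀ x, A x = f x := fun x => rfl
  have hAs : ∀ i, A.symm (u i) = b i := fun i => by
    rw [LinearEquiv.symm_apply_eq, hA, hfb]
  -- In the coordinates of `b`, the inverse of `A` turns each `u i` into a standard unit vector.
  let h : EuclideanSpace ℝ (Fin n) →ₗ[ℝ] (Fin n → ℝ) :=
    ((A.symm.trans b.repr.toLinearEquiv).trans (WithLp.linearEquiv 2 ℝ (Fin n → ℝ))).toLinearMap
  have hh : ∀ x, h x = WithLp.ofLp (b.repr (A.symm x)) := fun x => rfl
  have h1 := one_le_factorial_mul_volume_of_unit_segments (n := n) (K := h '' K)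
    (hK.image h.continuous_of_finiteDimensional) (hc.linear_image h) (hne.image h) fun i => by
      obtain ⟨x, hx, hx'⟩ := hu i
      refine ⟨_, ⟨x, hx, rfl⟩, _, hx', ?_⟩
      rw [map_add, hh (u i), hAs, b.repr_self]
      rfl
  have hvol : volume (h '' K) = volume (A.symm '' K) := by
    let e := b.measurableEquiv.trans (MeasurableEquiv.toLp 2 (Fin n → ℝ)).symm
    have he : MeasurePreserving e volume volume :=
      (PiLp.volume_preserving_ofLp (Fin n)).comp b.measurePreserving_measurableEquiv
    have : h '' K = e '' (A.symm '' K) := by rw [Set.image_image]; rfl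
    rw [this, e.image_eq_preimage_symm]
    exact he.symm.measure_preimage_equiv _
  have hKv : volume K = ENNReal.ofReal |b.toBasis.det u| * volume (A.symm '' K) := by
    rw [← hfdet, ← Measure.addHaar_image_linearMap, Set.image_image]
    simp [← hA]
  have hreal : volume.real K = |b.toBasis.det u| * volume.real (h '' K) := by
    rw [measureReal_def, hKv, ← hvol, ENNReal.toReal_mul, ENNReal.toReal_ofReal (abs_nonneg _),
      measureReal_def]
  have hfin : volume (h '' K) ≠ ⊤ :=
    (hK.image h.continuous_of_finiteDimensional).measure_ne_top
  have h2 : 1 ≤ (n ! : ℝ) * volume.real (h '' K) := by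
    have := ENNReal.toReal_mono (ENNReal.mul_ne_top (by simp) hfin) h1
    simpa [measureReal_def] using this
  rw [hreal]
  nlinarith [abs_nonneg (b.toBasis.det u)]

/-! ### First-order comparison, orthogonal dilations and Gram–Schmidt -/

/-- Both sides equal 1 at `σ = 0`, so their derivatives there compare. One explicit `σ` replaces the
limit. -/
theorem le_mul_of_one_add_pow_le {n m : ℕ} {q : ℝ} (hq : 0 ≤ q)
    (h : ∀ σ : ℝ, 0 < σ → (1 + σ) ^ m ≤ (1 + σ * q) ^ n) : (m : ℝ) ≤ n * q := by
  by_contra! hlt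
  set X := (n : ℝ) * q with hX
  have hX0 : 0 ≤ X := by positivity
  have hm : (0 : ℝ) < m := hX0.trans_lt hlt
  -- Bernoulli and `1 + x ≤ exp x` will give `m - X ≤ m * X * σ`; here `m - X = m * X * σ + m * m *
  -- σ`, which is larger.
  set σ := (m - X) / (m * (X + m)) with hσ
  have hσ0 : 0 < σ := div_pos (by linarith) (by positivity)
  have hσm : σ * (m * (X + m)) = m - X := by rw [hσ]; field_simp
  have hσX : σ * X < 1 := by
    by_contra! hge
    nlinarith [mul_pos hm (by positivity : 0 < X + m)]
  have h1 : 1 + m * σ ≤ (1 + σ) ^ m := by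
    have := one_add_mul_le_pow (by linarith : -2 ≤ σ) m
    linarith
  have h2 : (1 + σ * q) ^ n ≤ Real.exp (σ * X) := by
    calc (1 + σ * q) ^ n ≤ Real.exp (σ * q) ^ n := by
          gcongr
          linarith [Real.add_one_le_exp (σ * q)]
      _ = Real.exp (σ * X) := by rw [← Real.exp_nat_mul, hX]; congr 1; ring
  have h3 : Real.exp (σ * X) * (1 - σ * X) ≤ 1 := by
    have := Real.add_one_le_exp (-(σ * X))
    calc Real.exp (σ * X) * (1 - σ * X) ≤ Real.exp (σ * X) * Real.exp (-(σ * X)) := by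
          gcongr; linarith
      _ = 1 := by rw [← Real.exp_add]; simp
  have h4 : (1 + m * σ) * (1 - σ * X) ≤ 1 :=
    (mul_le_mul_of_nonneg_right (h1.trans ((h σ hσ0).trans h2)) (by linarith)).trans h3
  have h5 : σ * (m - X - m * X * σ) ≤ 0 := by linarith
  have h6 : m - X - m * X * σ ≤ 0 := by
    by_contra! hc
    linarith [mul_pos hσ0 hc]
  have : 0 < m * m * σ := by positivity
  linarith

section

variable {E : Type*} [NormedAddCommGroup E] [InnerProductSpace ℝ E]

/-- The linear map which is the identity on `F` and multiplication by `r` on `Fᗮ`. -/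
noncomputable def orthogonalDilation (F : Submodule ℝ E) [F.HasOrthogonalProjection] (r : ℝ) :
    E →ₗ[ℝ] E :=
  LinearMap.id + (r - 1) • (Fᗮ.starProjection : E →ₗ[ℝ] E)

theorem norm_orthogonalDilation_sq (F : Submodule ℝ E) [F.HasOrthogonalProjection] (r : ℝ) (v : E) :
    ‖orthogonalDilation F r v‖ ^ 2 = ‖v‖ ^ 2 + (r ^ 2 - 1) * ‖Fᗮ.starProjection v‖ ^ 2 := by
  have h1 : orthogonalDilation F r v = F.starProjection v + r • Fᗮ.starProjection v := by
    have := F.starProjection_add_starProjection_orthogonal v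
    simp only [orthogonalDilation, LinearMap.add_apply, LinearMap.id_apply, LinearMap.smul_apply,
      ContinuousLinearMap.coe_coe]
    nth_rw 1 [← this]
    module
  have h0 : inner ℝ (F.starProjection v) (Fᗮ.starProjection v) = 0 :=
    Submodule.inner_right_of_mem_orthogonal (F.starProjection_apply_mem v)
      (Fᗮ.starProjection_apply_mem v)
  have h2 : ‖v‖ ^ 2 = ‖F.starProjection v‖ ^ 2 + ‖Fᗮ.starProjection v‖ ^ 2 := by
    conv_lhs => rw [← F.starProjection_add_starProjection_orthogonal v]
    rw [norm_add_sq_real, h0]; ring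
  rw [h1, norm_add_sq_real, inner_smul_right, h0, norm_smul, mul_pow, h2, Real.norm_eq_abs, sq_abs]
  ring

theorem det_orthogonalDilation [FiniteDimensional ℝ E] (F : Submodule ℝ E) (r : ℝ) :
    LinearMap.det (orthogonalDilation F r) = r ^ (Module.finrank ℝ E - Module.finrank ℝ F) := by
  have hF : ∀ v ∈ F, orthogonalDilation F r v = v := fun v hv => by
    simp [orthogonalDilation, Submodule.starProjection_orthogonal_val,
      Submodule.starProjection_eq_self_iff.2 hv]
  have hle : F ≤ F.comap (orthogonalDilation F r) := fun v hv => by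
    rw [Submodule.mem_comap, hF v hv]; exact hv
  rw [LinearMap.det_eq_det_mul_det F _ hle]
  have h1 : (orthogonalDilation F r).restrict hle = LinearMap.id := by
    ext ⟨v, hv⟩
    simp [hF v hv]
  have h2 : F.mapQ F (orthogonalDilation F r) hle = r • LinearMap.id := by
    ext v
    simp only [LinearMap.comp_apply, Submodule.mkQ_apply, Submodule.mapQ_apply,
      LinearMap.smul_apply, LinearMap.id_apply]
    rw [← Submodule.Quotient.mk_smul, Submodule.Quotient.eq]
    have : orthogonalDilation F r v - r • v = (1 - r) • F.starProjection v := by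
      simp only [orthogonalDilation, LinearMap.add_apply, LinearMap.id_apply, LinearMap.smul_apply,
        ContinuousLinearMap.coe_coe, Submodule.starProjection_orthogonal_val]
      module
    rw [this]
    exact F.smul_mem _ (F.starProjection_apply_mem v)
  rw [h1, h2, LinearMap.det_id, one_mul, LinearMap.det_smul, LinearMap.det_id, mul_one,
    Submodule.finrank_quotient]

/-- The vector `u i` differs from its Gram–Schmidt vector by an element of `F`, so both project
alike to `Fᗮ`. -/
theorem le_norm_gramSchmidt {n : ℕ} (u : Fin n → E) (i : Fin n) (F : Submodule ℝ E)
    [F.HasOrthogonalProjection] (hF : F = Submodule.span ℝ (u '' Set.Iio i)) :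
    ‖Fᗮ.starProjection (u i)‖ ≤ ‖InnerProductSpace.gramSchmidt ℝ u i‖ := by
  have hmem : u i - InnerProductSpace.gramSchmidt ℝ u i ∈ F := by
    rw [InnerProductSpace.gramSchmidt_def, sub_sub_cancel, hF,
      ← InnerProductSpace.span_gramSchmidt_Iio]
    refine Submodule.sum_mem _ fun j hj => ?_
    rw [Submodule.starProjection_singleton]
    exact Submodule.smul_mem _ _ (Submodule.subset_span ⟨j, Finset.mem_Iio.1 hj, rfl⟩)
  have h0 : Fᗮ.starProjection (u i) = Fᗮ.starProjection (InnerProductSpace.gramSchmidt ℝ u i) := by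
    rw [← sub_eq_zero, ← map_sub, Submodule.starProjection_orthogonal_val,
      Submodule.starProjection_eq_self_iff.2 hmem, sub_self]
  rw [h0]
  exact Submodule.norm_starProjection_apply_le _ _

theorem norm_gramSchmidt_eq_inner {n : ℕ} [FiniteDimensional ℝ E]
    (h : Module.finrank ℝ E = Fintype.card (Fin n)) (u : Fin n → E) (i : Fin n)
    (hi : InnerProductSpace.gramSchmidt ℝ u i ≠ 0) :
    inner ℝ (InnerProductSpace.gramSchmidtOrthonormalBasis h u i) (u i) =
      ‖InnerProductSpace.gramSchmidt ℝ u i‖ := by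
  have hn : ‖InnerProductSpace.gramSchmidt ℝ u i‖ ≠ 0 := norm_ne_zero_iff.2 hi
  have hg : InnerProductSpace.gramSchmidtNormed ℝ u i ≠ 0 := by
    simp [InnerProductSpace.gramSchmidtNormed, hi]
  have h1 : inner ℝ (InnerProductSpace.gramSchmidt ℝ u i) (u i) =
      ‖InnerProductSpace.gramSchmidt ℝ u i‖ ^ 2 := by
    conv_lhs => rw [InnerProductSpace.gramSchmidt_def'' ℝ u i]
    rw [inner_add_right, inner_sum, Finset.sum_eq_zero, add_zero, real_inner_self_eq_norm_sq]
    intro j hj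
    rw [inner_smul_right, InnerProductSpace.gramSchmidt_orthogonal ℝ u (Finset.mem_Iio.1 hj).ne',
      mul_zero]
  rw [InnerProductSpace.gramSchmidtOrthonormalBasis_apply h hg,
    InnerProductSpace.gramSchmidtNormed, real_inner_smul_left, h1]
  simp only [RCLike.ofReal_real_eq_id, id_eq]
  field_simp

end

/-! ### Consequences of Behrend position -/

theorem isodiametricQuotient_image {n : ℕ} (K : Set (EuclideanSpace ℝ (Fin n)))
    (A : EuclideanSpace ℝ (Fin n) ≃ₗ[ℝ] EuclideanSpace ℝ (Fin n)) :
    isodiametricQuotient (A '' K) =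
      |LinearMap.det (A : EuclideanSpace ℝ (Fin n) →ₗ[ℝ] EuclideanSpace ℝ (Fin n))| *
        volume.real K / Metric.diam (A '' K) ^ n := by
  have := Measure.addHaar_image_linearMap volume
    (A : EuclideanSpace ℝ (Fin n) →ₗ[ℝ] EuclideanSpace ℝ (Fin n)) K
  rw [isodiametricQuotient, measureReal_def, measureReal_def]
  congr 1
  rw [LinearEquiv.coe_coe] at this
  rw [this, ENNReal.toReal_mul, ENNReal.toReal_ofReal (abs_nonneg _)]

theorem diam_pos_of_interior_nonempty {n : ℕ} (hn : 1 ≤ n) {K : Set (EuclideanSpace ℝ (Fin n))}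
    (hb : Bornology.IsBounded K) (hK : (interior K).Nonempty) : 0 < Metric.diam K := by
  have : NeZero n := ⟨by omega⟩
  refine Metric.diam_pos ?_ hb
  by_contra hc
  obtain ⟨x, hx⟩ := hK
  rw [(Set.not_nontrivial_iff.1 hc).eq_singleton_of_mem (interior_subset hx),
    interior_singleton] at hx
  exact hx

/-- The positive volume of `K` cancels from the maximality inequality, leaving only diameters and
the determinant. -/
theorem IsBehrendPosition.abs_det_mul_diam_pow_le {n : ℕ}
    {K : ConvexBody (EuclideanSpace ℝ (Fin n))} (h : IsBehrendPosition K)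
    (hint : (interior (K : Set (EuclideanSpace ℝ (Fin n)))).Nonempty)
    (hd : 0 < Metric.diam (K : Set (EuclideanSpace ℝ (Fin n))))
    (A : EuclideanSpace ℝ (Fin n) ≃ₗ[ℝ] EuclideanSpace ℝ (Fin n)) :
    |LinearMap.det (A : EuclideanSpace ℝ (Fin n) →ₗ[ℝ] EuclideanSpace ℝ (Fin n))| *
      Metric.diam (K : Set (EuclideanSpace ℝ (Fin n))) ^ n ≤
        Metric.diam (A '' (K : Set (EuclideanSpace ℝ (Fin n)))) ^ n := by
  have hle := h.2 ⟨A, rfl⟩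
  simp only at hle
  rw [isodiametricQuotient_image, isodiametricQuotient] at hle
  have hv : 0 < volume.real (K : Set (EuclideanSpace ℝ (Fin n))) := by
    rw [measureReal_def]
    exact ENNReal.toReal_pos (Measure.measure_pos_of_nonempty_interior _ hint).ne'
      K.isCompact.measure_ne_top
  have hAd : 0 < Metric.diam (A '' (K : Set (EuclideanSpace ℝ (Fin n)))) := by
    have hnt : (K : Set (EuclideanSpace ℝ (Fin n))).Nontrivial := by
      by_contra hc
      rw [Set.not_nontrivial_iff] at hc
      rw [Metric.diam_subsingleton hc] at hd
      exact hd.false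
    exact Metric.diam_pos (hnt.image A.injective)
      (K.isCompact.image A.toLinearMap.continuous_of_finiteDimensional).isBounded
  rw [div_le_div_iff₀ (by positivity) (by positivity)] at hle
  nlinarith

/-- In Behrend position, the difference set has vectors far away from any given subspace. -/
theorem IsBehrendPosition.exists_le_norm_starProjection {n : ℕ}
    {K : ConvexBody (EuclideanSpace ℝ (Fin n))} (h : IsBehrendPosition K)
    (hint : (interior (K : Set (EuclideanSpace ℝ (Fin n)))).Nonempty)
    (hd : 0 < Metric.diam (K : Set (EuclideanSpace ℝ (Fin n))))
    (F : Submodule ℝ (EuclideanSpace ℝ (Fin n))) :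
    ∃ x ∈ K, ∃ y ∈ K, ((n - Module.finrank ℝ F : ℕ) : ℝ) *
      Metric.diam (K : Set (EuclideanSpace ℝ (Fin n))) ^ 2 ≤
        n * ‖Fᗮ.starProjection (x - y)‖ ^ 2 := by
  set D := Metric.diam (K : Set (EuclideanSpace ℝ (Fin n))) with hD
  obtain ⟨⟨x, y⟩, ⟨hx, hy⟩, hmax⟩ := (K.isCompact.prod K.isCompact).exists_isMaxOn
    (K.nonempty.prod K.nonempty) (f := fun p : EuclideanSpace ℝ (Fin n) × EuclideanSpace ℝ (Fin n) =>
      ‖Fᗮ.starProjection (p.1 - p.2)‖) (by fun_prop)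
  refine ⟨x, hx, y, hy, ?_⟩
  have hmax' : ∀ a ∈ K, ∀ b ∈ K,
      ‖Fᗮ.starProjection (a - b)‖ ≤ ‖Fᗮ.starProjection (x - y)‖ :=
    fun a ha b hb => isMaxOn_iff.1 hmax (a, b) (Set.mk_mem_prod ha hb)
  clear hmax
  generalize ‖Fᗮ.starProjection (x - y)‖ = p at hmax' ⊢
  have key : ((n - Module.finrank ℝ F : ℕ) : ℝ) ≤ n * (p ^ 2 / D ^ 2) := by
    refine le_mul_of_one_add_pow_le (by positivity) fun σ hσ => ?_
    set r := √(1 + σ) with hr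
    have hr2 : r ^ 2 = 1 + σ := Real.sq_sqrt (by linarith)
    have hr0 : 0 < r := Real.sqrt_pos.2 (by linarith)
    have hdet : LinearMap.det (orthogonalDilation F r) = r ^ (n - Module.finrank ℝ F) := by
      rw [det_orthogonalDilation, finrank_euclideanSpace_fin]
    have hunit : IsUnit (LinearMap.det (orthogonalDilation F r)) := by
      rw [hdet]; exact isUnit_iff_ne_zero.2 (by positivity)
    obtain ⟨A, hA⟩ : ∃ A : EuclideanSpace ℝ (Fin n) ≃ₗ[ℝ] EuclideanSpace ℝ (Fin n),
        ∀ x, A x = orthogonalDilation F r x :=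
      ⟨LinearMap.equivOfIsUnitDet hunit, LinearMap.equivOfIsUnitDet_apply hunit⟩
    have hAc : (A : EuclideanSpace ℝ (Fin n) →ₗ[ℝ] EuclideanSpace ℝ (Fin n)) =
        orthogonalDilation F r := LinearMap.ext hA
    have h1 := h.abs_det_mul_diam_pow_le hint hd A
    rw [hAc, hdet, abs_of_pos (by positivity)] at h1
    have h2 : Metric.diam (A '' (K : Set (EuclideanSpace ℝ (Fin n)))) ≤ √(D ^ 2 + σ * p ^ 2) := by
      refine Metric.diam_le_of_forall_dist_le (Real.sqrt_nonneg _) ?_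
      rintro _ ⟨a, ha, rfl⟩ _ ⟨b, hb, rfl⟩
      refine Real.le_sqrt_of_sq_le ?_
      rw [dist_eq_norm, ← map_sub, hA, norm_orthogonalDilation_sq, hr2, add_sub_cancel_left]
      have h3 : ‖a - b‖ ≤ D := by
        rw [← dist_eq_norm]
        exact Metric.dist_le_diam_of_mem K.isCompact.isBounded ha hb
      have h4 : ‖Fᗮ.starProjection (a - b)‖ ≤ p := hmax' a ha b hb
      gcongr
    have h5 : r ^ (n - Module.finrank ℝ F) * D ^ n ≤ √(D ^ 2 + σ * p ^ 2) ^ n :=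
      h1.trans (pow_le_pow_left₀ Metric.diam_nonneg h2 n)
    have h6 : (1 + σ) ^ (n - Module.finrank ℝ F) * (D ^ 2) ^ n ≤ (D ^ 2 + σ * p ^ 2) ^ n := by
      have h0 : 0 ≤ r ^ (n - Module.finrank ℝ F) * D ^ n :=
        mul_nonneg (pow_nonneg hr0.le _) (pow_nonneg hd.le _)
      have hs : √(D ^ 2 + σ * p ^ 2) ^ 2 = D ^ 2 + σ * p ^ 2 := Real.sq_sqrt (by positivity)
      rw [← hr2, ← hs, pow_right_comm r 2, pow_right_comm D 2, pow_right_comm √(D ^ 2 + σ * p ^ 2) 2, ← mul_pow]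
      exact pow_le_pow_left₀ h0 h5 2
    have h7 : 1 + σ * (p ^ 2 / D ^ 2) = (D ^ 2 + σ * p ^ 2) / D ^ 2 := by field_simp
    rw [h7, div_pow, le_div_iff₀ (by positivity)]
    exact h6
  rw [← mul_div_assoc, le_div_iff₀ (by positivity)] at key
  exact key

/-- A body in Behrend position contains segments whose directions span a large volume. -/
theorem IsBehrendPosition.exists_orthonormalBasis_det {n : ℕ} (hn : 1 ≤ n)
    {K : ConvexBody (EuclideanSpace ℝ (Fin n))} (h : IsBehrendPosition K)
    (hint : (interior (K : Set (EuclideanSpace ℝ (Fin n)))).Nonempty)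
    (hd : 0 < Metric.diam (K : Set (EuclideanSpace ℝ (Fin n)))) :
    ∃ (b : OrthonormalBasis (Fin n) ℝ (EuclideanSpace ℝ (Fin n)))
      (u : Fin n → EuclideanSpace ℝ (Fin n)), (∀ i, ∃ x ∈ K, x + u i ∈ K) ∧
      √(n ! : ℝ) / √((n : ℝ) ^ n) * Metric.diam (K : Set (EuclideanSpace ℝ (Fin n))) ^ n ≤
        |b.toBasis.det u| := by
  set D := Metric.diam (K : Set (EuclideanSpace ℝ (Fin n))) with hD
  have hn' : (0 : ℝ) < n := by exact_mod_cast hn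
  choose X hX Y hY hXY using h.exists_le_norm_starProjection hint hd
  -- Greedy choice: `v k` is a difference of points of `K` far from the span of all earlier `v j`.
  let v : ℕ → EuclideanSpace ℝ (Fin n) := fun k => Nat.strongRec
    (fun k (w : ∀ j < k, EuclideanSpace ℝ (Fin n)) =>
      X (Submodule.span ℝ (Set.range fun j : Fin k => w j j.2)) -
        Y (Submodule.span ℝ (Set.range fun j : Fin k => w j j.2))) k
  have hv : ∀ k, v k = X (Submodule.span ℝ (Set.range fun j : Fin k => v j)) -
      Y (Submodule.span ℝ (Set.range fun j : Fin k => v j)) := fun k => by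
    simp only [v]
    rw [Nat.strongRec]
  let u : Fin n → EuclideanSpace ℝ (Fin n) := fun i => v i
  have hcard : Module.finrank ℝ (EuclideanSpace ℝ (Fin n)) = Fintype.card (Fin n) := by simp
  refine ⟨InnerProductSpace.gramSchmidtOrthonormalBasis hcard u, u, fun i =>
    ⟨_, hY (Submodule.span ℝ (Set.range fun j : Fin i => v j)), ?_⟩, ?_⟩
  · simp only [u]
    rw [hv i, add_sub_cancel]
    exact hX _
  have hg : ∀ i : Fin n, √(((n - i : ℕ) : ℝ) / n) * D ≤ ‖InnerProductSpace.gramSchmidt ℝ u i‖ := by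
    intro i
    have hspan : Submodule.span ℝ (Set.range fun j : Fin i => v j) =
        Submodule.span ℝ (u '' Set.Iio i) := by
      congr 1
      ext z
      constructor
      · rintro ⟨j, rfl⟩
        exact ⟨⟨j, j.2.trans i.2⟩, j.2, rfl⟩
      · rintro ⟨j, hj, rfl⟩
        exact ⟨⟨j, hj⟩, rfl⟩
    refine le_trans ?_ (le_norm_gramSchmidt u i _ hspan)
    set F := Submodule.span ℝ (Set.range fun j : Fin i => v j) with hF
    have h1 := hXY F
    rw [← hv i] at h1
    -- Only this upper bound is needed: a smaller span strengthens the estimate, so independence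
    -- need not be tracked.
    have hfr : Module.finrank ℝ F ≤ i := by
      exact (finrank_range_le_card (R := ℝ) (fun j : Fin i => v j)).trans_eq (Fintype.card_fin _)
    have h2 : ((n - i : ℕ) : ℝ) * D ^ 2 ≤ n * ‖Fᗮ.starProjection (v i)‖ ^ 2 := by
      refine le_trans ?_ h1
      gcongr
    refine abs_le_of_sq_le_sq' ?_ (norm_nonneg _) |>.2
    rw [mul_pow, Real.sq_sqrt (by positivity), div_mul_eq_mul_div, div_le_iff₀ hn', mul_comm _ (n : ℝ)]
    exact h2
  have hin : ∀ i : Fin n, inner ℝ (InnerProductSpace.gramSchmidtOrthonormalBasis hcard u i) (u i) =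
      ‖InnerProductSpace.gramSchmidt ℝ u i‖ := fun i => by
    refine norm_gramSchmidt_eq_inner hcard u i (norm_pos_iff.1 (lt_of_lt_of_le ?_ (hg i)))
    have : (0 : ℝ) < ((n - i : ℕ) : ℝ) := by exact_mod_cast Nat.sub_pos_of_lt i.2
    positivity
  rw [InnerProductSpace.gramSchmidtOrthonormalBasis_det, Finset.prod_congr rfl fun i _ => hin i,
    abs_of_nonneg (Finset.prod_nonneg fun i _ => norm_nonneg _)]
  calc √(n ! : ℝ) / √((n : ℝ) ^ n) * D ^ n = ∏ i : Fin n, √(((n - i : ℕ) : ℝ) / n) * D := by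
        rw [Finset.prod_mul_distrib, ← Real.sqrt_prod _ (fun i _ => by positivity),
          Finset.prod_div_distrib, Real.sqrt_div (by positivity)]
        simp only [Finset.prod_const, Finset.card_univ, Fintype.card_fin]
        congr 3
        rw [Fin.prod_univ_eq_prod_range (fun i => ((n - i : ℕ) : ℝ)) n, ← Nat.cast_prod,
          ← Nat.descFactorial_eq_prod_range, Nat.descFactorial_self]
    _ ≤ _ := Finset.prod_le_prod (fun i _ => by positivity) fun i _ => hg i

theorem IsBehrendPosition.behrendBound_le {n : ℕ} (hn : 1 ≤ n)
    {K : ConvexBody (EuclideanSpace ℝ (Fin n))} (h : IsBehrendPosition K)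
    (hint : (interior (K : Set (EuclideanSpace ℝ (Fin n)))).Nonempty) :
    behrendBound n ≤ isodiametricQuotient (K : Set (EuclideanSpace ℝ (Fin n))) := by
  have hd := diam_pos_of_interior_nonempty hn K.isCompact.isBounded hint
  have hn' : (0 : ℝ) < n := by exact_mod_cast hn
  obtain ⟨b, u, hu, hdet⟩ := h.exists_orthonormalBasis_det hn hint hd
  have h1 := hdet.trans (abs_det_le_factorial_mul_volume K.isCompact K.convex K.nonempty b u hu)
  have e1 : (n : ℝ) ^ ((n : ℝ) / 2) = √((n : ℝ) ^ n) := by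
    rw [Real.sqrt_eq_rpow, ← Real.rpow_natCast, ← Real.rpow_mul hn'.le]
    congr 1; ring
  rw [behrendBound, isodiametricQuotient, e1, le_div_iff₀ (by positivity)]
  have hf : (n ! : ℝ) = √(n ! : ℝ) * √(n ! : ℝ) := (Real.mul_self_sqrt (by positivity)).symm
  have hf0 : 0 < √(n ! : ℝ) := by positivity
  have hq0 : 0 < √((n : ℝ) ^ n) := by positivity
  refine le_of_mul_le_mul_left (le_trans (le_of_eq ?_) h1) (by positivity : (0 : ℝ) < n !)
  generalize √(n ! : ℝ) = f at *
  rw [hf]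
  field_simp

theorem mainTheorem2 :
    (∀ (n : ℕ), 1 ≤ n → ∀ K : ConvexBody (EuclideanSpace ℝ (Fin n)),
      (interior (K : Set (EuclideanSpace ℝ (Fin n)))).Nonempty → IsBehrendPosition K →
        behrendBound n ≤ isodiametricQuotient (K : Set (EuclideanSpace ℝ (Fin n)))) ∧
    (behrendBound ~[atTop] fun n : ℕ =>
      (2 * Real.pi * (n : ℝ)) ^ (1 / 4 : ℝ) / Real.sqrt ((n : ℝ) + 1) * comparisonBound n) ∧
    Tendsto (fun n : ℕ => (behrendBound n / comparisonBound n) ^ (1 / (n : ℝ))) atTop (𝓝 1) ∧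
    (∀ c : ℝ, 0 < c → c < 1 → ∀ᶠ n : ℕ in atTop,
      ∀ K : ConvexBody (EuclideanSpace ℝ (Fin n)),
        (interior (K : Set (EuclideanSpace ℝ (Fin n)))).Nonempty → IsBehrendPosition K →
          c ^ n * comparisonBound n ≤
            isodiametricQuotient (K : Set (EuclideanSpace ℝ (Fin n)))) := by
  refine ⟨fun n hn K hint hK => hK.behrendBound_le hn hint, behrendBound_isEquivalent,
    tendsto_behrendBound_div_comparisonBound_rpow, fun c hc hc1 => ?_⟩
  filter_upwards [eventually_pow_mul_comparisonBound_le hc hc1, eventually_ge_atTop 1]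
    with n h hn K hint hK
  exact h.trans (hK.behrendBound_le hn hint)
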